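/- Let $K$ be a CM field of degree $6$ over $\mathbb{Q}$, with maximal totally real subfield $K_0$, complex conjugation $\varrho$ (written $x \mapsto \overline{x}$), ring of integers $\mathbb{Z}_K$ and class group $\mathrm{Cl}(K)$. Let $L$ be the Galois closure of $K$ over $\mathbb{Q}$, with ring of integers $\mathbb{Z}_L$, and suppose that $\mathrm{Gal}(L|\mathbb{Q})$ is isomorphic to the cyclic group $C_6$ of order $6$ or to the dihedral group $D_6$ of order $12$. A CM type of $K$ is a subset $\Phi \subset \mathrm{Hom}(K, L)$ such that $\mathrm{Hom}(K, L)$ is the disjoint union of $\Phi$ and $\Phi\varrho$. It is primitive if there are no CM field $F \subsetneq K$ and CM type $\Phi_0 \subset \mathrm{Hom}(F, L)$ of $F$ with $\Phi = \{\varphi : \varphi|_F \in \Phi_0\}$. Put $\Phi_L = \{\sigma \in \mathrm{Gal}(L|\mathbb{Q}) : \sigma|_K \in \Phi\}$. The reflex field $K^r$ of $\Phi$ is the fixed field in $L$ of the group $\{\sigma \in \mathrm{Gal}(L|\mathbb{Q}) : \sigma\Phi_L = \Phi_L\}$, the reflex type of $\Phi$ is $\Phi^r = \{\sigma^{-1}|_{K^r}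 : \sigma \in \Phi_L\} \subset \mathrm{Hom}(K^r, L)$, and the reflex type norm is the map $$N_{\Phi^r} : \mathrm{Cl}(K^r) \to \mathrm{Cl}(K), \qquad [\mathfrak{a}] \mapsto \Bigl[\mathbb{Z}_K \cap \prod_{\varphi \in \Phi^r} \varphi(\mathfrak{a})\mathbb{Z}_L\Bigr],$$ where $\mathfrak{a}$ is a nonzero integral ideal of $K^r$ representing the class. Let $\Phi$ be a primitive CM type of $K$, and let $\mathfrak{b}$ be a nonzero fractional ideal of $\mathbb{Z}_K$ such that $\mathfrak{b}\overline{\mathfrak{b}} = \beta\mathbb{Z}_K$ for some $\beta \in K_0^*$. Then $[\mathfrak{b}^2]$ lies in the image of $N_{\Phi^r} : \mathrm{Cl}(K^r) \to \mathrm{Cl}(K)$. -/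

import Mathlib

open scoped NumberField nonZeroDivisors Pointwise

namespace CMReflex

section

variable (K L : Type*) [Field K] [NumberField K] [NumberField.IsCMField K]
  [Field L] [NumberField L]

/-- Complex conjugation `ϱ` of the CM field `K`, as a homomorphism of `ℚ`-algebras. -/
noncomputable def conjHom : K →ₐ[ℚ] K :=
  ((NumberField.IsCMField.complexConj K).restrictScalars ℚ : K →ₐ[ℚ] K)

/-- A CM type of `K` with values in `L`: a set `Φ` of embeddings `K → L` such that
`Hom(K, L)` is the disjoint union of `Φ` and `Φϱ`. -/
structure CMType where
  embeddings : Set (K →ₐ[ℚ] L)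
  disjoint_conj : Disjoint embeddings ((fun φ => φ.comp (conjHom K)) '' embeddings)
  union_conj : embeddings ∪ (fun φ => φ.comp (conjHom K)) '' embeddings = Set.univ

end

section

variable {K L : Type*} [Field K] [NumberField K] [NumberField.IsCMField K]
  [Field L] [NumberField L]

/-- `Φ` is induced by the CM type `Φ₀` of the CM subfield `F` of `K`: it consists of the
embeddings of `K` whose restriction to `F` lies in `Φ₀`. -/
def CMType.IsInducedBy (Φ : CMType K L) (F : IntermediateField ℚ K) [NumberField.IsCMField F]
    (Φ₀ : CMType F L) : Prop :=
  Φ.embeddings = {φ | φ.comp F.val ∈ Φ₀.embeddings}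

/-- A CM type is primitive if it is not induced by a CM type of a strict CM subfield. -/
def CMType.IsPrimitive (Φ : CMType K L) : Prop :=
  ∀ (F : IntermediateField ℚ K) [NumberField.IsCMField F] (Φ₀ : CMType F L),
    F ≠ ⊤ → ¬ Φ.IsInducedBy F Φ₀

variable [Algebra K L]

/-- The lift `Φ_L` of `Φ` to `L`, as a subset of `Gal(L | ℚ)`. -/
def CMType.lift (Φ : CMType K L) : Set (L ≃ₐ[ℚ] L) :=
  {σ | (σ : L →ₐ[ℚ] L).comp (IsScalarTower.toAlgHom ℚ K L) ∈ Φ.embeddings}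

/-- The group `H^r` of all `σ` in `Gal(L | ℚ)` with `σ Φ_L = Φ_L`. -/
def CMType.reflexGroup (Φ : CMType K L) : Subgroup (L ≃ₐ[ℚ] L) :=
  MulAction.stabilizer (L ≃ₐ[ℚ] L) Φ.lift

/-- The reflex field `K^r`: the subfield of `L` fixed by `H^r`. -/
def CMType.reflexField (Φ : CMType K L) : IntermediateField ℚ L :=
  IntermediateField.fixedField Φ.reflexGroup

/-- The reflex type `Φ^r`: the restrictions to `K^r` of the elements of `Φ_L⁻¹`. -/
def CMType.reflexType (Φ : CMType K L) : Set (Φ.reflexField →ₐ[ℚ] L) :=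
  (fun σ : L ≃ₐ[ℚ] L => (σ : L →ₐ[ℚ] L).comp Φ.reflexField.val) '' (Φ.lift)⁻¹

/-- The type `Φ_L⁻¹` of `L` is induced by `Φ^r`. -/
theorem CMType.mem_reflexType_iff (Φ : CMType K L) (σ : L ≃ₐ[ℚ] L) :
    (σ : L →ₐ[ℚ] L).comp Φ.reflexField.val ∈ Φ.reflexType ↔ σ ∈ (Φ.lift)⁻¹ := by
  refine ⟨?_, fun h => ⟨σ, h, rfl⟩⟩
  rintro ⟨τ, hτ, h⟩
  have hmem : τ⁻¹ * σ ∈ Φ.reflexGroup := by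
    rw [← IntermediateField.fixingSubgroup_fixedField Φ.reflexGroup,
      IntermediateField.mem_fixingSubgroup_iff]
    intro x hx
    have := DFunLike.congr_fun h (⟨x, hx⟩ : Φ.reflexField)
    have h2 : τ x = σ x := this
    change τ⁻¹ (σ x) = x
    rw [← h2]
    exact τ.symm_apply_apply x
  have h3 : (τ⁻¹ * σ) • Φ.lift = Φ.lift := hmem
  rw [Set.mem_inv] at hτ ⊢
  rw [← h3, Set.mem_smul_set_iff_inv_smul_mem] at hτ
  simpa [smul_eq_mul, mul_assoc] using hτ

end

section

variable {F K L : Type*} [Field F] [NumberField F] [Field K] [NumberField K]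
  [Field L] [NumberField L] [Algebra K L]

/-- The ideal `∏_{φ ∈ E} φ(𝔞) ℤ_L` of `ℤ_L`, for a set `E` of embeddings `F → L` and an ideal
`𝔞` of `ℤ_F`. -/
noncomputable def prodEmb (E : Set (F →ₐ[ℚ] L)) (𝔞 : Ideal (𝓞 F)) : Ideal (𝓞 L) :=
  ∏ᶠ φ ∈ E, 𝔞.map (NumberField.RingOfIntegers.mapRingHom φ)

/-- The ideal `ℤ_K ∩ ∏_{φ ∈ E} φ(𝔞) ℤ_L` of `ℤ_K`. -/
noncomputable def typeNormIdeal (K : Type*) [Field K] [NumberField K] [Algebra K L]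
    (E : Set (F →ₐ[ℚ] L)) (𝔞 : Ideal (𝓞 F)) : Ideal (𝓞 K) :=
  (prodEmb E 𝔞).comap (algebraMap (𝓞 K) (𝓞 L))

theorem prodEmb_ne_bot (E : Set (F →ₐ[ℚ] L)) {𝔞 : Ideal (𝓞 F)} (h : 𝔞 ≠ ⊥) :
    prodEmb E 𝔞 ≠ ⊥ := by
  unfold prodEmb
  rw [finprod_mem_eq_finite_toFinset_prod _ (Set.toFinite E)]
  refine Finset.prod_ne_zero_iff.mpr fun φ _ hφ => h ?_
  refine (Ideal.map_eq_bot_iff_of_injective ?_).mp hφ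
  intro x y hxy
  have : φ x = φ y := congrArg (fun z : 𝓞 L => (z : L)) hxy
  exact NumberField.RingOfIntegers.ext (φ.injective this)

theorem typeNormIdeal_ne_bot (E : Set (F →ₐ[ℚ] L)) {𝔞 : Ideal (𝓞 F)} (h : 𝔞 ≠ ⊥) :
    typeNormIdeal K E 𝔞 ≠ ⊥ :=
  Ideal.comap_ne_bot_of_algebraic_mem
    (x := ((Submodule.exists_mem_ne_zero_of_ne_bot (prodEmb_ne_bot E h)).choose))
    (Submodule.exists_mem_ne_zero_of_ne_bot (prodEmb_ne_bot E h)).choose_spec.2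
    (Submodule.exists_mem_ne_zero_of_ne_bot (prodEmb_ne_bot E h)).choose_spec.1
    (Algebra.IsAlgebraic.isAlgebraic _)

/-- The map `𝔞 ↦ ℤ_K ∩ ∏_{φ ∈ E} φ(𝔞) ℤ_L` on nonzero integral ideals. -/
noncomputable def typeNorm₀ (K : Type*) [Field K] [NumberField K] [Algebra K L]
    (E : Set (F →ₐ[ℚ] L)) (𝔞 : (Ideal (𝓞 F))⁰) : (Ideal (𝓞 K))⁰ :=
  ⟨typeNormIdeal K E 𝔞,
    mem_nonZeroDivisors_of_ne_zero (typeNormIdeal_ne_bot E (nonZeroDivisors.coe_ne_zero 𝔞))⟩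

end

section

variable {K L : Type*} [Field K] [NumberField K] [NumberField.IsCMField K]
  [Field L] [NumberField L] [Algebra K L]

/-- The reflex type norm `N_{Φ^r} : Cl(K^r) → Cl(K)`, which sends the class of a nonzero integral
ideal `𝔞` to the class of `ℤ_K ∩ ∏_{φ ∈ Φ^r} φ(𝔞) ℤ_L`. It is computed on a chosen representative;
`CMType.reflexTypeNorm_mk0` shows that every other representative gives the same class. -/
noncomputable def CMType.reflexTypeNorm (Φ : CMType K L) :
    ClassGroup (𝓞 Φ.reflexField) → ClassGroup (𝓞 K) := fun c =>
  ClassGroup.mk0 (typeNorm₀ K Φ.reflexType (Function.surjInv ClassGroup.mk0_surjective c))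

/-- The reflex type norm of an algebraic integer of `K^r` is an algebraic integer of `K`. -/
theorem CMType.exists_reflexNorm [Normal ℚ L] (Φ : CMType K L) (x : 𝓞 Φ.reflexField) :
    ∃ y : 𝓞 K, algebraMap (𝓞 K) (𝓞 L) y =
      ∏ᶠ φ ∈ Φ.reflexType, NumberField.RingOfIntegers.mapRingHom φ x := by
  classical
  have : IsGalois ℚ L := ⟨⟩
  have : IsGalois K L := IsGalois.tower_top_of_isGalois ℚ K L
  set z : 𝓞 L := ∏ᶠ φ ∈ Φ.reflexType, NumberField.RingOfIntegers.mapRingHom φ x with hz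
  have hzc : (z : L) = ∏ φ ∈ (Set.toFinite Φ.reflexType).toFinset, φ (x : Φ.reflexField) := by
    rw [hz, finprod_mem_eq_finite_toFinset_prod _ (Set.toFinite Φ.reflexType)]
    exact map_prod (algebraMap (𝓞 L) L) _ _
  have key : ∀ τ : L ≃ₐ[K] L, τ (z : L) = z := by
    intro τ
    rw [hzc, map_prod]
    have hstab : ∀ (τ : L ≃ₐ[K] L), ∀ φ ∈ Φ.reflexType,
        ((τ.restrictScalars ℚ : L ≃ₐ[ℚ] L) : L →ₐ[ℚ] L).comp φ ∈ Φ.reflexType := by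
      rintro τ _ ⟨σ, hσ, rfl⟩
      refine ⟨τ.restrictScalars ℚ * σ, ?_, rfl⟩
      rw [Set.mem_inv] at hσ ⊢
      have h0 : ((σ⁻¹ : L ≃ₐ[ℚ] L) : L →ₐ[ℚ] L).comp (IsScalarTower.toAlgHom ℚ K L)
          ∈ Φ.embeddings := hσ
      change (((τ.restrictScalars ℚ * σ)⁻¹ : L ≃ₐ[ℚ] L) : L →ₐ[ℚ] L).comp
        (IsScalarTower.toAlgHom ℚ K L) ∈ Φ.embeddings
      convert h0 using 1
      ext k
      change σ.symm (τ.symm (algebraMap K L k)) = σ.symm (algebraMap K L k)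
      rw [τ.symm.commutes]
    refine Finset.prod_bij'
      (fun φ _ => ((τ.restrictScalars ℚ : L ≃ₐ[ℚ] L) : L →ₐ[ℚ] L).comp φ)
      (fun φ _ => ((τ.symm.restrictScalars ℚ : L ≃ₐ[ℚ] L) : L →ₐ[ℚ] L).comp φ)
      ?_ ?_ ?_ ?_ ?_
    · intro φ hφ
      rw [Set.Finite.mem_toFinset] at hφ ⊢
      exact hstab τ φ hφ
    · intro φ hφ
      rw [Set.Finite.mem_toFinset] at hφ ⊢
      exact hstab τ.symm φ hφ
    · intro φ _
      ext a
      exact τ.symm_apply_apply (φ a)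
    · intro φ _
      ext a
      exact τ.apply_symm_apply (φ a)
    · intro φ _
      rfl
  obtain ⟨y, hy⟩ := (IsGalois.mem_range_algebraMap_iff_fixed (F := K) (z : L)).mpr key
  have hyint : IsIntegral ℤ y := by
    have h1 : IsIntegral ℤ (algebraMap K L y) := hy ▸ z.isIntegral_coe
    exact (isIntegral_algebraMap_iff (algebraMap K L).injective).mp h1
  exact ⟨⟨y, hyint⟩, NumberField.RingOfIntegers.ext hy⟩

/-- The value of the reflex type norm does not depend on the chosen representative. -/
theorem CMType.reflexTypeNorm_mk0 [Normal ℚ L] (Φ : CMType K L)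
    (𝔞 : (Ideal (𝓞 Φ.reflexField))⁰) :
    Φ.reflexTypeNorm (ClassGroup.mk0 𝔞) = ClassGroup.mk0 (typeNorm₀ K Φ.reflexType 𝔞) := by
  classical
  have hinj : Function.Injective (algebraMap (𝓞 K) (𝓞 L)) :=
    FaithfulSMul.algebraMap_injective _ _
  have hspan : ∀ x : 𝓞 Φ.reflexField, x ≠ 0 → ∃ y : 𝓞 K, y ≠ 0 ∧
      ∀ J : Ideal (𝓞 Φ.reflexField), typeNormIdeal K Φ.reflexType (Ideal.span {x} * J) =
        Ideal.span {y} * typeNormIdeal K Φ.reflexType J := by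
    intro x hx
    obtain ⟨y, hy⟩ := Φ.exists_reflexNorm x
    have hprod : ∀ J : Ideal (𝓞 Φ.reflexField), prodEmb Φ.reflexType (Ideal.span {x} * J) =
        Ideal.span {algebraMap (𝓞 K) (𝓞 L) y} * prodEmb Φ.reflexType J := by
      intro J
      unfold prodEmb
      rw [hy]
      simp only [finprod_mem_eq_finite_toFinset_prod _ (Set.toFinite Φ.reflexType)]
      simp only [Ideal.map_mul, Ideal.map_span, Set.image_singleton, Finset.prod_mul_distrib,
        Ideal.prod_span_singleton]
    have hy0 : y ≠ 0 := by
      rintro rfl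
      have h := prodEmb_ne_bot Φ.reflexType (𝔞 := Ideal.span {x} * ⊤)
        (by simpa using hx)
      rw [hprod] at h
      simp at h
    refine ⟨y, hy0, fun J => ?_⟩
    unfold typeNormIdeal
    rw [hprod]
    ext w
    rw [Ideal.mem_comap, Ideal.mem_span_singleton_mul, Ideal.mem_span_singleton_mul]
    constructor
    · rintro ⟨u, hu, hw⟩
      have hy0' : algebraMap K L y ≠ 0 := by
        rw [Ne, map_eq_zero]
        exact NumberField.RingOfIntegers.coe_ne_zero_iff.mpr hy0
      have hwL : algebraMap K L y * (u : L) = algebraMap K L w :=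
        congrArg (fun z : 𝓞 L => (z : L)) hw
      have hu' : algebraMap K L ((w : K) / (y : K)) = (u : L) := by
        rw [map_div₀, ← hwL, mul_div_cancel_left₀ _ hy0']
      have hint : IsIntegral ℤ ((w : K) / (y : K)) := by
        have h1 : IsIntegral ℤ (algebraMap K L ((w : K) / (y : K))) := hu' ▸ u.isIntegral_coe
        exact (isIntegral_algebraMap_iff (algebraMap K L).injective).mp h1
      obtain ⟨q, hq⟩ : ∃ q : 𝓞 K, (q : K) = (w : K) / (y : K) := ⟨⟨_, hint⟩, rfl⟩
      have hv : algebraMap (𝓞 K) (𝓞 L) q = u :=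
        NumberField.RingOfIntegers.ext ((congrArg (algebraMap K L) hq).trans hu')
      refine ⟨q, ?_, ?_⟩
      · rw [Ideal.mem_comap, hv]
        exact hu
      · apply hinj
        rw [map_mul, hv, hw]
    · rintro ⟨v, hv, rfl⟩
      exact ⟨_, hv, (map_mul _ _ _).symm⟩
  unfold CMType.reflexTypeNorm
  have h := Function.surjInv_eq ClassGroup.mk0_surjective (ClassGroup.mk0 𝔞)
  rw [ClassGroup.mk0_eq_mk0_iff] at h ⊢
  obtain ⟨x, y, hx, hy, h⟩ := h
  obtain ⟨x', hx', h1⟩ := hspan x hx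
  obtain ⟨y', hy', h2⟩ := hspan y hy
  refine ⟨x', y', hx', hy', ?_⟩
  change Ideal.span {x'} * typeNormIdeal K _ _ = Ideal.span {y'} * typeNormIdeal K _ _
  rw [← h1, ← h2, h]

end

section

variable {K : Type*} [Field K] [NumberField K] [NumberField.IsCMField K]

/-- The complex conjugate of a fractional ideal `𝔟`, generated over `ℤ_K` by the conjugates of
the elements of `𝔟`. -/
noncomputable def conjIdeal (𝔟 : FractionalIdeal (𝓞 K)⁰ K) : FractionalIdeal (𝓞 K)⁰ K :=
  𝔟.extended K (f := NumberField.RingOfIntegers.mapRingHom (conjHom K : K →+* K))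
    (nonZeroDivisors_le_comap_nonZeroDivisors_of_injective _ fun _ _ h =>
      NumberField.RingOfIntegers.ext ((conjHom K).injective
        (congrArg (fun z : 𝓞 K => (z : K)) h)))

/-- An element lies in the conjugate of `𝔟` exactly when its conjugate lies in `𝔟`. -/
theorem mem_conjIdeal_iff (𝔟 : FractionalIdeal (𝓞 K)⁰ K) (x : K) :
    x ∈ conjIdeal 𝔟 ↔ NumberField.IsCMField.complexConj K x ∈ 𝔟 := by
  have hmap : ∀ z : K, IsLocalization.map (S := K) (M := (𝓞 K)⁰) (T := (𝓞 K)⁰) K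
      (NumberField.RingOfIntegers.mapRingHom (conjHom K : K →+* K))
      (nonZeroDivisors_le_comap_nonZeroDivisors_of_injective _ fun _ _ h =>
        NumberField.RingOfIntegers.ext ((conjHom K).injective
          (congrArg (fun z : 𝓞 K => (z : K)) h))) z = NumberField.IsCMField.complexConj K z := by
    intro z
    obtain ⟨a, s, rfl⟩ := IsLocalization.exists_mk'_eq (𝓞 K)⁰ z
    rw [IsLocalization.map_mk', IsFractionRing.mk'_eq_div, IsFractionRing.mk'_eq_div, map_div₀]
    rfl
  unfold conjIdeal
  rw [FractionalIdeal.mem_extended_iff]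
  constructor
  · intro hx
    induction hx using Submodule.span_induction with
    | mem z hz =>
      obtain ⟨w, hw, rfl⟩ := hz
      rw [hmap, NumberField.IsCMField.complexConj_apply_apply]
      exact hw
    | zero => rw [map_zero]; exact 𝔟.zero_mem
    | add u v _ _ hu hv => rw [map_add]; exact (𝔟 : Submodule (𝓞 K) K).add_mem hu hv
    | smul a u _ hu =>
      have : NumberField.IsCMField.complexConj K (a • u) =
          NumberField.IsCMField.ringOfIntegersComplexConj K a •
            NumberField.IsCMField.complexConj K u := by
        rw [Algebra.smul_def, Algebra.smul_def, map_mul]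
        rfl
      rw [this]
      exact (𝔟 : Submodule (𝓞 K) K).smul_mem _ hu
  · intro hx
    refine Submodule.subset_span ⟨_, hx, ?_⟩
    rw [hmap, NumberField.IsCMField.complexConj_apply_apply]

end

end CMReflex

namespace CMReflex

/-! ### Relative norms of ideals and products of Galois conjugates -/

section RelNorm

/-! Let `H` be the subgroup of `Gal(L/ℚ)` fixing `K`. In both the cyclic and the dihedral case there
is a rotation `r` of order 6 with `r ^ 3 = c` complex conjugation, the powers of `r` represent the
cosets of `H`, and each element of `H` commutes with `r` or inverts it (`exists_rotationData`). A CM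
type is then a choice of one exponent modulo 6 from each opposite pair `i`, `i + 3`: either an arc
`k - 1, k, k + 1` or a parity class. A parity class is induced from an imaginary quadratic subfield,
so a primitive type is an arc (`CMType.exists_zpow_mem_lift`).

For an arc, the reflex group is `r ^ k H r ^ (-k)` and the reflex type is represented by `r ^ (-k)`
times `r⁻¹, 1, r` (`IsTypeSet.mem_stabilizer_iff`, `CMType.reflexType_eq`). Let `B` be the extension
to `L` of an integral ideal in the class of `𝔟`. The product of `r ^ (k + 1) • B` and `r ^ (k - 1) •
B` comes from an ideal `J` of the reflex field (`CMType.exists_map_eq_smul_mul_smul`). Writing `T =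
r + r⁻¹`, the type norm of `J` is `(1 + T) T` applied to `B`, and `(1 + T) T = 2 + T (1 + c)`
(`RotationData.smul_prod_eq`). Since `B * c • B` is principal, what remains beside `B ^ 2` is
principal, with a generator fixed by `H`, hence in `K`. -/

theorem eq_of_dvd_of_absNorm_eq {S : Type*} [CommRing S] [IsDedekindDomain S]
    [Module.Free ℤ S] {I J : Ideal S} (hJ : J.absNorm ≠ 0) (h : I ∣ J)
    (hn : I.absNorm = J.absNorm) : I = J := by
  obtain ⟨C, rfl⟩ := h
  rw [map_mul] at hn hJ
  have : C.absNorm = 1 := by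
    have h0 : I.absNorm ≠ 0 := left_ne_zero_of_mul hJ
    exact Nat.eq_of_mul_eq_mul_left (Nat.pos_of_ne_zero h0) (by rw [← hn, mul_one])
  rw [Ideal.absNorm_eq_one_iff] at this
  rw [this, Ideal.mul_top]

variable {F L : Type*} [Field F] [NumberField F] [Field L] [NumberField L] [Algebra F L]

theorem absNorm_galSmul {G : Type*} [Group G] [MulSemiringAction G L] (g : G) (I : Ideal (𝓞 L)) :
    Ideal.absNorm (g • I) = Ideal.absNorm I := by
  have h (J : Ideal (𝓞 L)) := Ideal.absNorm_relNorm ℤ (𝓞 L) J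
  rw [← h, Ideal.relNorm_smul, h]

theorem algebraMap_intNorm_eq_prod [IsGalois F L] (x : 𝓞 L) :
    algebraMap (𝓞 F) (𝓞 L) (Algebra.intNorm (𝓞 F) (𝓞 L) x) = ∏ τ : Gal(L/F), τ • x := by
  apply NumberField.RingOfIntegers.ext
  change algebraMap F L (algebraMap (𝓞 F) F _) = _
  rw [Algebra.algebraMap_intNorm (L := L), Algebra.norm_eq_prod_automorphisms]
  refine Eq.symm ?_
  refine (map_prod (algebraMap (𝓞 L) L) (fun τ : Gal(L/F) => τ • x) Finset.univ).trans ?_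
  rfl

/-- The extension to `L` of the relative norm of `I` is the product of the conjugates of `I`. -/
theorem map_relNorm_eq_prod [IsGalois F L] (I : Ideal (𝓞 L)) :
    (Ideal.relNorm (𝓞 F) I).map (algebraMap (𝓞 F) (𝓞 L)) = ∏ τ : Gal(L/F), τ • I := by
  rcases eq_or_ne I ⊥ with rfl | hI
  · rw [Ideal.relNorm_bot, Ideal.map_bot, eq_comm]
    refine Finset.prod_eq_zero (Finset.mem_univ 1) (one_smul _ _)
  symm
  refine eq_of_dvd_of_absNorm_eq ?_ ?_ ?_
  · rw [Ideal.absNorm_algebraMap, Ideal.absNorm_relNorm]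
    exact pow_ne_zero _ (by rwa [Ne, Ideal.absNorm_eq_zero_iff])
  -- The relative norm is generated by norms of elements of `I`, each a product of conjugates. This
  -- gives divisibility; both absolute norms are the `[L : F]`-th power of that of `I`.
  · rw [Ideal.dvd_iff_le, Ideal.map_relNorm, Ideal.span_le]
    rintro _ ⟨x, hx, rfl⟩
    change algebraMap (𝓞 F) (𝓞 L) (Algebra.intNorm (𝓞 F) (𝓞 L) x) ∈ _
    rw [algebraMap_intNorm_eq_prod]
    exact Ideal.prod_mem_prod fun τ _ => Ideal.smul_mem_pointwise_smul τ x I hx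
  · rw [Ideal.absNorm_algebraMap, Ideal.absNorm_relNorm, map_prod]
    simp only [absNorm_galSmul, Finset.prod_const, Finset.card_univ]
    rw [← Nat.card_eq_fintype_card, IsGalois.card_aut_eq_finrank,
      IsFractionRing.finrank_eq (𝓞 F) F (𝓞 L) L]

/-- For a subgroup `R` of `Gal(L | ℚ)`, the product of the `R`-conjugates of an ideal of `ℤ_L`
is extended from the fixed field of `R`. -/
theorem exists_map_eq_finprod_smul [IsGalois ℚ L] (R : Subgroup Gal(L/ℚ)) (I : Ideal (𝓞 L)) :
    ∃ J : Ideal (𝓞 (IntermediateField.fixedField R)),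
      J.map (algebraMap (𝓞 (IntermediateField.fixedField R)) (𝓞 L)) = ∏ᶠ τ ∈ R, τ • I := by
  refine ⟨Ideal.relNorm _ I, ?_⟩
  rw [map_relNorm_eq_prod, ← finprod_eq_prod_of_fintype]
  have h := finprod_set_coe_eq_finprod_mem (R : Set Gal(L/ℚ)) (f := fun τ => τ • I)
  refine Eq.trans ?_ h
  let e : R ≃ Gal(L/IntermediateField.fixedField R) :=
    (Equiv.setCongr (congrArg _ (IntermediateField.fixingSubgroup_fixedField R).symm)).trans
      (IntermediateField.fixingSubgroupEquiv (IntermediateField.fixedField R)).toEquiv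
  exact (finprod_comp_equiv e).symm

/-- Evaluates the contraction in the type norm once the product is known to be extended from `K`. -/
theorem comap_map_algebraMap {E M : Type*} [Field E] [NumberField E] [Field M] [Algebra E M]
    (I : Ideal (𝓞 E)) :
    (I.map (algebraMap (𝓞 E) (𝓞 M))).comap (algebraMap (𝓞 E) (𝓞 M)) = I :=
  Ideal.comap_map_eq_self_of_faithfullyFlat I

theorem map_mapRingHom_comp_val {F : IntermediateField ℚ L} (σ : Gal(L/ℚ)) (J : Ideal (𝓞 F)) :
    J.map (NumberField.RingOfIntegers.mapRingHom ((σ : L →ₐ[ℚ] L).comp F.val)) =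
      σ • J.map (algebraMap (𝓞 F) (𝓞 L)) := by
  rw [Ideal.pointwise_smul_def, Ideal.map_map]
  rfl

end RelNorm

/-! ### Rotations in the cyclic and dihedral groups -/

section Group

variable {G : Type*} [Group G]

/-- The conjugation relations between a rotation `r` and a subgroup `H` of a cyclic group of
order `6` or a dihedral group of order `12`, with `r ^ 3` playing the role of complex
conjugation. -/
structure RotationData (c : G) (H : Subgroup G) (r : G) : Prop where
  cube : r ^ 3 = c
  sq : c * c = 1
  conj_eq : ∀ h ∈ H, h * r = r * h ∨ h * r = r⁻¹ * h
  exists_zpow : ∀ g : G, ∃ i : ℤ, r ^ (-i) * g ∈ H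
  dvd_of_mem : ∀ i : ℤ, r ^ i ∈ H → (6 : ℤ) ∣ i
  subgroup_eq : H = ⊥ ∨ ∃ t, t ≠ 1 ∧ (H : Set G) = {1, t} ∧ t * r = r⁻¹ * t

theorem exists_rotationData_of_dihedral {c : DihedralGroup 6} {H : Subgroup (DihedralGroup 6)}
    (hH : Nat.card H = 2) (hc : ∀ g, c * g = g * c) (hc2 : c * c = 1) (hcH : c ∉ H) :
    ∃ r, RotationData c H r := by
  -- The centre of the dihedral group of order 12 is `{1, r 3}`.
  have hc3 : c = DihedralGroup.r 3 := by
    have h1 : c ≠ 1 := fun h => hcH (h ▸ H.one_mem)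
    clear hcH hc2
    revert hc h1
    revert c
    decide
  obtain ⟨t, ht1, htH⟩ : ∃ t, t ≠ 1 ∧ (H : Set (DihedralGroup 6)) = {1, t} := by
    obtain ⟨x, y, hxy, h⟩ := Set.ncard_eq_two.mp ((Nat.card_coe_set_eq _).symm.trans hH :
      (H : Set (DihedralGroup 6)).ncard = 2)
    have h1 : (1 : DihedralGroup 6) ∈ (H : Set (DihedralGroup 6)) := H.one_mem
    rw [h] at h1
    rcases h1 with rfl | rfl
    · exact ⟨y, hxy.symm, h⟩
    · exact ⟨x, hxy, by rw [h, Set.pair_comm]⟩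
  have hmem (g) : g ∈ H ↔ g = 1 ∨ g = t := by
    rw [← SetLike.mem_coe, htH]; rfl
  -- Every involution other than the central `r 3` is a reflection.
  obtain ⟨i, rfl⟩ : ∃ i, t = DihedralGroup.sr i := by
    have h2 : t * t = 1 := by
      have : t * t ∈ H := H.mul_mem ((hmem t).2 (.inr rfl)) ((hmem t).2 (.inr rfl))
      rcases (hmem _).1 this with h | h
      · exact h
      · exact absurd (mul_eq_left.mp h) ht1
    have h3 : t ≠ DihedralGroup.r 3 := fun h => hcH ((hmem c).2 (.inr (hc3.trans h.symm)))
    clear hmem htH hc3 hc hc2 hcH hH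
    revert h2 h3 ht1
    revert t
    decide
  have hrel : DihedralGroup.sr i * DihedralGroup.r 1 =
      (DihedralGroup.r 1)⁻¹ * DihedralGroup.sr i := by
    clear hmem htH ht1; revert i; decide
  have hz (j : ℤ) : (DihedralGroup.r 1 : DihedralGroup 6) ^ j = DihedralGroup.r j := by
    simp
  refine ⟨DihedralGroup.r 1, ?_, hc2, ?_, ?_, ?_, .inr ⟨_, ht1, htH, hrel⟩⟩
  · rw [hc3]; decide
  · intro h hh
    rcases (hmem h).1 hh with rfl | rfl
    · left; simp
    · exact .inr hrel
  · intro g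
    rcases g with j | j
    · refine ⟨j.val, (hmem _).2 (.inl ?_)⟩
      rw [zpow_neg, hz]; simp
    -- As `r a * sr b = sr (b - a)`, this exponent moves `sr j` to the reflection `sr i` in `H`.
    · refine ⟨(i - j).val, (hmem _).2 (.inr ?_)⟩
      rw [zpow_neg, hz]; simp
  · intro j hj
    rw [hz] at hj
    rcases (hmem _).1 hj with h | h
    · rw [DihedralGroup.one_def, DihedralGroup.r.injEq, ZMod.intCast_zmod_eq_zero_iff_dvd] at h
      exact_mod_cast h
    · cases h

theorem exists_rotationData_of_cyclic {c : Multiplicative (ZMod 6)}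
    {H : Subgroup (Multiplicative (ZMod 6))} (hH : H = ⊥) (hc2 : c * c = 1) (hcH : c ∉ H) :
    ∃ r, RotationData c H r := by
  subst hH
  have hc3 : c = Multiplicative.ofAdd 3 := by
    have h1 : c ≠ 1 := fun h => hcH (h ▸ Subgroup.one_mem _)
    clear hcH
    revert h1 hc2
    revert c
    decide
  have hz (j : ℤ) : (Multiplicative.ofAdd (1 : ZMod 6)) ^ j = Multiplicative.ofAdd (j : ZMod 6) := by
    rw [← ofAdd_zsmul]; simp
  refine ⟨Multiplicative.ofAdd 1, by rw [hc3]; decide, hc2, fun h _ => .inl (mul_comm _ _), ?_, ?_,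
    .inl rfl⟩
  · intro g
    refine ⟨(Multiplicative.toAdd g).val, ?_⟩
    rw [zpow_neg, hz, Subgroup.mem_bot]
    simp
  · intro j hj
    rw [hz, Subgroup.mem_bot, ofAdd_eq_one, ZMod.intCast_zmod_eq_zero_iff_dvd] at hj
    exact_mod_cast hj

/-- Transports the computations in the model groups to the Galois group. -/
theorem RotationData.map {G' : Type*} [Group G'] (e : G' ≃* G) {c : G'} {H : Subgroup G'} {r : G}
    (h : RotationData (e c) (H.map e.toMonoidHom) r) : RotationData c H (e.symm r) := by
  have hm (x : G) : x ∈ H.map e.toMonoidHom ↔ e.symm x ∈ H := Subgroup.mem_map_equiv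
  have hm' (x : G') : x ∈ H ↔ e x ∈ H.map e.toMonoidHom := by simp
  refine ⟨?_, ?_, ?_, ?_, ?_, ?_⟩
  · apply e.injective; simpa using h.cube
  · apply e.injective; simpa using h.sq
  · intro x hx
    refine (h.conj_eq (e x) ((hm' x).1 hx)).imp ?_ ?_ <;>
    · intro h'; apply e.injective; simpa using h'
  · intro g
    obtain ⟨i, hi⟩ := h.exists_zpow (e g)
    refine ⟨i, (hm' _).2 ?_⟩
    simpa using hi
  · intro i hi
    refine h.dvd_of_mem i ((hm _).2 ?_)
    simpa using hi
  · refine h.subgroup_eq.imp ?_ ?_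
    · intro h'
      rw [Subgroup.map_eq_bot_iff_of_injective _ e.injective] at h'
      exact h'
    · rintro ⟨t, ht, hH, hr⟩
      refine ⟨e.symm t, by simpa using ht, ?_, ?_⟩
      · ext x
        have : e x ∈ ((H.map e.toMonoidHom : Subgroup G) : Set G) ↔ e x ∈ ({1, t} : Set G) := by
          rw [hH]
        rw [SetLike.mem_coe, ← hm'] at this
        rw [SetLike.mem_coe, this]
        simp [MulEquiv.eq_symm_apply]
      · rw [← map_mul, hr]; simp

end Group

/-! ### Combinatorics of type sets: arcs and parity classes -/

section GroupType

variable {G : Type*} [Group G] {c r : G} {H : Subgroup G}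

theorem RotationData.zpow_add_three (h : RotationData c H r) (i : ℤ) :
    r ^ (i + 3) = c * r ^ i := by
  rw [add_comm, zpow_add, ← h.cube]; norm_cast

theorem RotationData.zpow_eq_one (h : RotationData c H r) {i : ℤ} (hi : 6 ∣ i) : r ^ i = 1 := by
  obtain ⟨m, rfl⟩ := hi
  have : r ^ (6 : ℤ) = 1 := by
    rw [show (6 : ℤ) = 0 + 3 + 3 by norm_num, h.zpow_add_three, h.zpow_add_three, ← mul_assoc,
      h.sq, zpow_zero, mul_one]
  rw [zpow_mul, this, one_zpow]

/-- The choice between commuting and inverting depends on `x` only, so later arguments split once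
for all exponents. -/
theorem RotationData.mul_zpow (h : RotationData c H r) {x : G} (hx : x ∈ H) :
    (∀ j : ℤ, x * r ^ j = r ^ j * x) ∨ ∀ j : ℤ, x * r ^ j = r ^ (-j) * x := by
  refine (h.conj_eq x hx).imp (fun h' j => ?_) fun h' j => ?_
  · exact SemiconjBy.zpow_right (a := x) (x := r) (y := r) h' j
  · rw [zpow_neg, ← inv_zpow]
    exact SemiconjBy.zpow_right (a := x) (x := r) (y := r⁻¹) h' j

/-- A subset of `G` that behaves like the lift of a CM type: it is a union of left cosets of `H`
and contains exactly one of `g` and `c * g`. -/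
structure IsTypeSet (c : G) (H : Subgroup G) (T : Set G) : Prop where
  mul_mem_iff : ∀ g, ∀ x ∈ H, g * x ∈ T ↔ g ∈ T
  conj_mem_iff : ∀ g, c * g ∈ T ↔ g ∉ T

variable {T : Set G}

theorem IsTypeSet.zpow_add_three (hT : IsTypeSet c H T) (h : RotationData c H r) (i : ℤ) :
    r ^ (i + 3) ∈ T ↔ r ^ i ∉ T := by
  rw [h.zpow_add_three, hT.conj_mem_iff]

theorem IsTypeSet.zpow_congr (h : RotationData c H r) {i j : ℤ} (hij : 6 ∣ i - j) :
    r ^ i ∈ T ↔ r ^ j ∈ T := by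
  rw [show i = (i - j) + j by ring, zpow_add, h.zpow_eq_one hij, one_mul]

theorem IsTypeSet.mem_iff_zpow (hT : IsTypeSet c H T) {g : G} {i : ℤ}
    (hi : r ^ (-i) * g ∈ H) : g ∈ T ↔ r ^ i ∈ T := by
  rw [← hT.mul_mem_iff (r ^ i) _ hi, ← mul_assoc, ← zpow_add]
  simp

theorem IsTypeSet.exists_or_forall (hT : IsTypeSet c H T) (h : RotationData c H r) :
    (∃ k : ℤ, r ^ (k - 1) ∈ T ∧ r ^ k ∈ T ∧ r ^ (k + 1) ∈ T) ∨
      ∀ i : ℤ, r ^ (i + 2) ∈ T ↔ r ^ i ∈ T := by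
  have h3 := hT.zpow_add_three h 0
  have h4 := hT.zpow_add_three h 1
  have h5 := hT.zpow_add_three h 2
  -- The arcs centred at 0 and 5 leave the window `0, …, 5` at `-1` and `6`.
  have hm1 := IsTypeSet.zpow_congr (T := T) h (i := -1) (j := 5) (by norm_num)
  have h6 := IsTypeSet.zpow_congr (T := T) h (i := 6) (j := 0) (by norm_num)
  norm_num only at h3 h4 h5 hm1 h6
  have hper (i : ℤ) := IsTypeSet.zpow_congr (T := T) h (i := i) (j := i % 6) (by omega)
  -- Exponents 0, 1, 2 determine 3, 4, 5. Of the eight patterns six are arcs, whose centre is the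
  -- witness, and two are parity classes.
  by_cases h0 : r ^ (0 : ℤ) ∈ T <;> by_cases h1 : r ^ (1 : ℤ) ∈ T <;>
    by_cases h2 : r ^ (2 : ℤ) ∈ T <;> simp only [h0, h1, h2, not_true, not_false_iff] at h3 h4 h5
  · exact .inl ⟨1, h0, h1, h2⟩
  · exact .inl ⟨0, hm1.2 (h5.2 trivial), h0, h1⟩
  · refine .inr fun i => ?_
    rw [hper (i + 2), hper i]
    have : i % 6 = 0 ∧ (i + 2) % 6 = 2 ∨ i % 6 = 1 ∧ (i + 2) % 6 = 3 ∨
      i % 6 = 2 ∧ (i + 2) % 6 = 4 ∨ i % 6 = 3 ∧ (i + 2) % 6 = 5 ∨ i % 6 = 4 ∧ (i + 2) % 6 = 0 ∨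
      i % 6 = 5 ∧ (i + 2) % 6 = 1 := by omega
    rcases this with h' | h' | h' | h' | h' | h' <;> rw [h'.1, h'.2] <;>
      simp only [h0, h1, h2, h3, h4, h5]
  · exact .inl ⟨5, h4.2 trivial, h5.2 trivial, h6.2 h0⟩
  · exact .inl ⟨2, h1, h2, h3.2 trivial⟩
  · refine .inr fun i => ?_
    rw [hper (i + 2), hper i]
    have : i % 6 = 0 ∧ (i + 2) % 6 = 2 ∨ i % 6 = 1 ∧ (i + 2) % 6 = 3 ∨
      i % 6 = 2 ∧ (i + 2) % 6 = 4 ∨ i % 6 = 3 ∧ (i + 2) % 6 = 5 ∨ i % 6 = 4 ∧ (i + 2) % 6 = 0 ∨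
      i % 6 = 5 ∧ (i + 2) % 6 = 1 := by omega
    rcases this with h' | h' | h' | h' | h' | h' <;> rw [h'.1, h'.2] <;>
      simp only [h0, h1, h2, h3, h4, h5]
  · exact .inl ⟨3, h2, h3.2 trivial, h4.2 trivial⟩
  · exact .inl ⟨4, h3.2 trivial, h4.2 trivial, h5.2 trivial⟩

/-- The arc around `k` and the opposite arc, which is outside `T`, exhaust the residues modulo 6. -/
theorem IsTypeSet.zpow_mem_iff (hT : IsTypeSet c H T) (h : RotationData c H r) {k : ℤ}
    (h1 : r ^ (k - 1) ∈ T) (h2 : r ^ k ∈ T) (h3 : r ^ (k + 1) ∈ T) (i : ℤ) :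
    r ^ i ∈ T ↔ 6 ∣ i - k ∨ 6 ∣ i - k - 1 ∨ 6 ∣ i - k + 1 := by
  have h4 := hT.zpow_add_three h (k - 1)
  have h5 := hT.zpow_add_three h k
  have h6 := hT.zpow_add_three h (k + 1)
  have : 6 ∣ i - (k - 1) ∨ 6 ∣ i - k ∨ 6 ∣ i - (k + 1) ∨ 6 ∣ i - (k - 1 + 3) ∨ 6 ∣ i - (k + 3) ∨
    6 ∣ i - (k + 1 + 3) := by omega
  rcases this with h' | h' | h' | h' | h' | h' <;> rw [IsTypeSet.zpow_congr h h']
  · exact iff_of_true h1 (by omega)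
  · exact iff_of_true h2 (by omega)
  · exact iff_of_true h3 (by omega)
  · exact iff_of_false (by tauto) (by omega)
  · exact iff_of_false (by tauto) (by omega)
  · exact iff_of_false (by tauto) (by omega)

/-- Left multiplication by `x` acts on exponents modulo 6 by a shift or a reflection, and an arc is
preserved only by the identity and the reflection about its centre `k`. -/
theorem IsTypeSet.mem_stabilizer_iff (hT : IsTypeSet c H T) (h : RotationData c H r) {k : ℤ}
    (hk : ∀ i : ℤ, r ^ i ∈ T ↔ 6 ∣ i - k ∨ 6 ∣ i - k - 1 ∨ 6 ∣ i - k + 1) (x : G) :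
    x ∈ MulAction.stabilizer G T ↔ r ^ (-k) * x * r ^ k ∈ H := by
  rw [MulAction.mem_stabilizer_set]
  simp only [smul_eq_mul]
  constructor
  · intro hx
    obtain ⟨j, hj⟩ := h.exists_zpow (r ^ (-k) * x * r ^ k)
    set y := r ^ (-j) * (r ^ (-k) * x * r ^ k) with hy
    have hxy : x = r ^ (k + j) * y * r ^ (-k) := by
      rw [hy]; simp only [zpow_add, zpow_neg]; group
    -- The factor `y⁻¹` is free by right `H`-invariance and turns `y * r ^ e` into `r ^ e` or `r ^
    -- (-e)`.
    have key (e : ℤ) : r ^ (k + e) ∈ T ↔ (r ^ (k + j) * (y * r ^ e)) * y⁻¹ ∈ T := by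
      rw [hT.mul_mem_iff _ _ (H.inv_mem hj), ← hx, hxy]
      congr! 1
      simp only [zpow_add, zpow_neg]; group
    have key' : (∀ e : ℤ, r ^ (k + e) ∈ T ↔ r ^ (k + j + e) ∈ T) ∨
        ∀ e : ℤ, r ^ (k + e) ∈ T ↔ r ^ (k + j + -e) ∈ T := by
      refine (h.mul_zpow hj).imp (fun h' e => ?_) fun h' e => ?_
      · rw [key, h', zpow_add r (k + j)]; simp [mul_assoc]
      · rw [key, h', zpow_add r (k + j)]; simp [mul_assoc]
    have hj6 : 6 ∣ j := by
      simp only [hk] at key'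
      rcases key' with h' | h'
      · have h0 := (h' 0).1 (by omega)
        have h1 := (h' 1).1 (by omega)
        have h2 := (h' (-1)).1 (by omega)
        omega
      · have h0 := (h' 0).1 (by omega)
        have h1 := (h' 1).1 (by omega)
        have h2 := (h' (-1)).1 (by omega)
        omega
    rwa [hy, h.zpow_eq_one (by omega), one_mul] at hj
  · intro hx g
    obtain ⟨i, hi⟩ := h.exists_zpow g
    have key (m : ℤ) : r ^ (-m) * (x * g) =
        r ^ (k - m) * ((r ^ (-k) * x * r ^ k) * r ^ (i - k)) * (r ^ (-i) * g) := by
      simp only [zpow_sub, zpow_neg]; group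
    rw [hT.mem_iff_zpow hi, hk]
    rcases h.mul_zpow hx with h' | h'
    · rw [hT.mem_iff_zpow (i := i), hk]
      rw [key, h', ← mul_assoc (r ^ (k - i)), ← zpow_add, h.zpow_eq_one (by omega), one_mul]
      exact H.mul_mem hx hi
    -- `2 * k - i` is the reflection of `i` about the centre.
    · rw [hT.mem_iff_zpow (i := 2 * k - i), hk]
      · omega
      rw [key, h', ← mul_assoc (r ^ (k - _)), ← zpow_add, h.zpow_eq_one (by omega), one_mul]
      exact H.mul_mem hx hi

/-- For a parity class the stabilizer contains `H` and the even rotations. It misses `c`, an odd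
rotation. -/
theorem IsTypeSet.index_stabilizer_eq_two (hT : IsTypeSet c H T) (h : RotationData c H r)
    (h2 : ∀ i : ℤ, r ^ (i + 2) ∈ T ↔ r ^ i ∈ T) :
    (MulAction.stabilizer G T).index = 2 ∧ H ≤ MulAction.stabilizer G T ∧
      r ^ (2 : ℤ) ∈ MulAction.stabilizer G T ∧ c ∉ MulAction.stabilizer G T := by
  have hc : c ∉ MulAction.stabilizer G T := by
    rw [MulAction.mem_stabilizer_set]
    intro hc
    have h1 := hc 1
    rw [smul_eq_mul, hT.conj_mem_iff] at h1
    tauto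
  have hr : r ^ (2 : ℤ) ∈ MulAction.stabilizer G T := by
    rw [MulAction.mem_stabilizer_set]
    intro g
    obtain ⟨i, hi⟩ := h.exists_zpow g
    rw [smul_eq_mul, hT.mem_iff_zpow hi, ← h2, hT.mem_iff_zpow (i := i + 2)]
    convert hi using 1
    rw [← mul_assoc, ← zpow_add]
    congr 2; ring
  have hpar (i : ℤ) (hi : 2 ∣ i) : r ^ i ∈ MulAction.stabilizer G T := by
    obtain ⟨m, rfl⟩ := hi
    rw [zpow_mul]
    exact Subgroup.zpow_mem _ hr m
  have hH : H ≤ MulAction.stabilizer G T := by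
    intro x hx
    rw [MulAction.mem_stabilizer_set]
    intro g
    obtain ⟨i, hi⟩ := h.exists_zpow g
    rw [smul_eq_mul, hT.mem_iff_zpow hi]
    rcases h.mul_zpow hx with h' | h'
    · rw [hT.mem_iff_zpow (i := i)]
      rw [← mul_assoc, ← h', mul_assoc]
      exact H.mul_mem hx hi
    · rw [hT.mem_iff_zpow (i := -i)]
      · have := (MulAction.mem_stabilizer_set.1 (hpar (2 * i) ⟨i, rfl⟩)) (r ^ (-i))
        rw [smul_eq_mul, ← zpow_add] at this
        rw [← this]
        congr! 2; ring
      · have h'' := h' (-i)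
        rw [← mul_assoc, ← h'', mul_assoc]
        exact H.mul_mem hx hi
  -- Multiplication by `c` adds 3 to the exponent and so changes its parity.
  refine ⟨Subgroup.index_eq_two_iff'.2 ⟨c, fun g => ?_⟩, hH, hr, hc⟩
  obtain ⟨i, hi⟩ := h.exists_zpow g
  have hcg : c * g ∈ MulAction.stabilizer G T ↔ g ∉ MulAction.stabilizer G T := by
    constructor
    · exact fun h1 h2 => hc ((Subgroup.mul_mem_cancel_right _ h2).1 h1)
    · intro hg
      have hi2 : ¬ 2 ∣ i := fun hi2 => hg (by
        rw [← mul_inv_cancel_left (r ^ i) g, ← zpow_neg]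
        exact Subgroup.mul_mem _ (hpar i hi2) (hH hi))
      have : c * g = r ^ (i + 3) * (r ^ (-i) * g) := by
        rw [h.zpow_add_three, mul_assoc, ← mul_assoc (r ^ i), ← zpow_add]; simp
      rw [this]
      exact Subgroup.mul_mem _ (hpar _ (by omega)) (hH hi)
  rw [xor_iff_iff_not, hcg]

end GroupType

/-! ### Galois groups of normal closures -/

section Galois

/-- The normal closure `L` is generated by the images of `K`. -/
theorem eq_of_forall_embedding (K : Type*) {L : Type*} [Field K] [NumberField K] [Field L]
    [NumberField L] [IsNormalClosure ℚ K L] {σ τ : Gal(L/ℚ)}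
    (h : ∀ (φ : K →ₐ[ℚ] L) (x : K), σ (φ x) = τ (φ x)) :
    σ = τ := by
  have htop : (⨆ f : K →ₐ[ℚ] L, f.fieldRange) = ⊤ :=
    (Algebra.IsAlgebraic.isNormalClosure_iff.1 ‹IsNormalClosure ℚ K L›).2
  have hle : (⨆ f : K →ₐ[ℚ] L, f.fieldRange) ≤
      IntermediateField.fixedField (Subgroup.zpowers (τ⁻¹ * σ)) := by
    refine iSup_le fun f => ?_
    rw [IntermediateField.le_iff_le, Subgroup.zpowers_le, IntermediateField.mem_fixingSubgroup_iff]
    rintro _ ⟨x, rfl⟩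
    change τ.symm (σ (f x)) = f x
    rw [h, AlgEquiv.symm_apply_apply]
  ext x
  have hx := (htop ▸ hle) (IntermediateField.mem_top (x := x))
  rw [IntermediateField.mem_fixedField_iff] at hx
  have h1 : τ.symm (σ x) = x := hx _ (Subgroup.mem_zpowers _)
  rw [← h1, AlgEquiv.apply_symm_apply, h1]

variable (K L : Type*) [Field K] [NumberField K] [Field L] [NumberField L] [Algebra K L]

/-- The subgroup of `Gal(L | ℚ)` that fixes the image of `K`. -/
def fixingGroup : Subgroup Gal(L/ℚ) :=
  (IsScalarTower.toAlgHom ℚ K L).fieldRange.fixingSubgroup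

variable {K L}

theorem mem_fixingGroup_iff {σ : Gal(L/ℚ)} :
    σ ∈ fixingGroup K L ↔ ∀ x : K, σ (algebraMap K L x) = algebraMap K L x := by
  rw [fixingGroup, IntermediateField.mem_fixingSubgroup_iff]
  constructor
  · exact fun h x => h _ ⟨x, rfl⟩
  · rintro h _ ⟨x, rfl⟩
    exact h x

theorem exists_comp_toAlgHom [Normal ℚ L] (φ : K →ₐ[ℚ] L) :
    ∃ σ : Gal(L/ℚ), (σ : L →ₐ[ℚ] L).comp (IsScalarTower.toAlgHom ℚ K L) = φ := by
  refine ⟨AlgEquiv.ofBijective (φ.liftNormal L) (Algebra.IsAlgebraic.algHom_bijective _), ?_⟩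
  ext x
  exact φ.liftNormal_commutes L x

theorem card_eq_six_mul_card_fixingGroup [IsGalois ℚ L] (hdeg : Module.finrank ℚ K = 6) :
    Nat.card Gal(L/ℚ) = 6 * Nat.card (fixingGroup K L) := by
  rw [IsGalois.card_aut_eq_finrank, fixingGroup, IsGalois.card_fixingSubgroup_eq_finrank,
    ← hdeg, (AlgEquiv.ofInjectiveField (IsScalarTower.toAlgHom ℚ K L)).toLinearEquiv.finrank_eq]
  exact (Module.finrank_mul_finrank ℚ (IsScalarTower.toAlgHom ℚ K L).fieldRange L).symm

end Galois

/-! ### Complex conjugation in the Galois group -/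

section Conj

variable {K L : Type*} [Field K] [NumberField K] [NumberField.IsCMField K]
  [Field L] [NumberField L]

theorem conjHom_conjHom (x : K) : conjHom K (conjHom K x) = x :=
  NumberField.IsCMField.complexConj_apply_apply K x

theorem exists_conjHom_ne : ∃ x : K, conjHom K x ≠ x := by
  by_contra! h
  exact NumberField.IsCMField.complexConj_ne_one K (AlgEquiv.ext h)

variable (K L) in
/-- Complex conjugation of a Galois extension of `ℚ` restricts, under every embedding of a CM
field, to complex conjugation of that field. -/
theorem exists_conj [IsGalois ℚ L] : ∃ c : Gal(L/ℚ), ∀ (φ : K →ₐ[ℚ] L) (x : K),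
    c (φ x) = φ (conjHom K x) := by
  let e : L →+* ℂ := Classical.choice inferInstance
  -- The Galois group is transitive on complex embeddings, so it links `e` to its conjugate.
  obtain ⟨σ, hσ⟩ := NumberField.ComplexEmbedding.exists_comp_symm_eq_of_comp_eq (k := ℚ) e
    (NumberField.ComplexEmbedding.conjugate e) (RingHom.ext_rat _ _)
  refine ⟨σ.symm, fun φ x => e.injective ?_⟩
  have h1 := RingHom.congr_fun hσ (φ x)
  have h2 := NumberField.IsCMField.complexEmbedding_complexConj K (e.comp (φ : K →+* L)) x
  refine Eq.trans h1 (Eq.trans ?_ h2.symm)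
  rfl

/-- On images of `K`, `c` acts by precomposition with conjugation and `σ` by postcomposition, so
they commute. -/
theorem conj_central [IsNormalClosure ℚ K L] {c : Gal(L/ℚ)}
    (hc : ∀ (φ : K →ₐ[ℚ] L) (x : K), c (φ x) = φ (conjHom K x))
    (σ : Gal(L/ℚ)) : c * σ = σ * c := by
  refine eq_of_forall_embedding K fun φ x => ?_
  refine (hc ((σ : L →ₐ[ℚ] L).comp φ) x).trans ?_
  exact congrArg σ (hc φ x).symm

theorem conj_mul_self [IsNormalClosure ℚ K L] {c : Gal(L/ℚ)}
    (hc : ∀ (φ : K →ₐ[ℚ] L) (x : K), c (φ x) = φ (conjHom K x)) :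
    c * c = 1 := by
  refine eq_of_forall_embedding K fun φ x => ?_
  change c (c (φ x)) = φ x
  rw [hc, hc, conjHom_conjHom]

variable [Algebra K L]

theorem conj_notMem {c : Gal(L/ℚ)} (hc : ∀ (φ : K →ₐ[ℚ] L) (x : K), c (φ x) = φ (conjHom K x)) :
    c ∉ fixingGroup K L := by
  obtain ⟨x, hx⟩ := exists_conjHom_ne (K := K)
  rw [mem_fixingGroup_iff]
  intro h
  refine hx ((algebraMap K L).injective ?_)
  rw [← h x]
  exact (hc (IsScalarTower.toAlgHom ℚ K L) x).symm

theorem isTypeSet_lift {c : Gal(L/ℚ)}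
    (hc : ∀ (φ : K →ₐ[ℚ] L) (x : K), c (φ x) = φ (conjHom K x)) (Φ : CMType K L) :
    IsTypeSet c (fixingGroup K L) Φ.lift := by
  have hconj (φ : K →ₐ[ℚ] L) : φ.comp (conjHom K) ∈ Φ.embeddings ↔ φ ∉ Φ.embeddings := by
    constructor
    · intro h1 h2
      exact Set.disjoint_left.1 Φ.disjoint_conj h1 ⟨φ, h2, rfl⟩
    · intro h
      have h1 : φ ∈ Φ.embeddings ∪ (fun φ => φ.comp (conjHom K)) '' Φ.embeddings :=
        Φ.union_conj ▸ Set.mem_univ φ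
      obtain h1 | ⟨ψ, hψ, rfl⟩ := h1
      · exact absurd h1 h
      · convert hψ
        ext x
        exact congrArg ψ (conjHom_conjHom x)
  constructor
  · intro g x hx
    have : ((g * x : Gal(L/ℚ)) : L →ₐ[ℚ] L).comp (IsScalarTower.toAlgHom ℚ K L) =
        (g : L →ₐ[ℚ] L).comp (IsScalarTower.toAlgHom ℚ K L) := by
      ext y
      exact congrArg g (mem_fixingGroup_iff.1 hx y)
    simp only [CMType.lift, Set.mem_ofPred_eq, this]
  · intro g
    change _ ↔ ¬ (_ ∈ Φ.embeddings)
    rw [← hconj]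
    have : ((c * g : Gal(L/ℚ)) : L →ₐ[ℚ] L).comp (IsScalarTower.toAlgHom ℚ K L) =
        ((g : L →ₐ[ℚ] L).comp (IsScalarTower.toAlgHom ℚ K L)).comp (conjHom K) := by
      ext y
      exact hc ((g : L →ₐ[ℚ] L).comp (IsScalarTower.toAlgHom ℚ K L)) y
    simp only [CMType.lift, Set.mem_ofPred_eq, this]

variable [IsNormalClosure ℚ K L]

/-- Since `H` has index 6, its order is 1 or 2; `c` is a central involution outside `H`, as the
model groups require. -/
theorem exists_rotationData (hdeg : Module.finrank ℚ K = 6)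
    (hgal : Nonempty (Gal(L/ℚ) ≃* Multiplicative (ZMod 6)) ∨
      Nonempty (Gal(L/ℚ) ≃* DihedralGroup 6))
    {c : Gal(L/ℚ)} (hc : ∀ (φ : K →ₐ[ℚ] L) (x : K), c (φ x) = φ (conjHom K x)) :
    ∃ r, RotationData c (fixingGroup K L) r := by
  have : Normal ℚ L := IsNormalClosure.normal (K := K)
  have : IsGalois ℚ L := ⟨⟩
  have hcard := card_eq_six_mul_card_fixingGroup (L := L) hdeg
  have hcc := conj_mul_self hc
  have hcH := conj_notMem hc
  rcases hgal with ⟨⟨e⟩⟩ | ⟨⟨e⟩⟩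
  · rw [Nat.card_congr e.toEquiv] at hcard
    have h1 : Nat.card (fixingGroup K L) = 1 := by
      have : Nat.card (Multiplicative (ZMod 6)) = 6 := by simp
      omega
    have hbot := Subgroup.eq_bot_of_card_eq _ h1
    obtain ⟨r, hr⟩ := exists_rotationData_of_cyclic (c := e c)
      (H := (fixingGroup K L).map e.toMonoidHom) (by rw [hbot, Subgroup.map_bot])
      (by rw [← map_mul, hcc, map_one]) (by simpa using hcH)
    exact ⟨_, hr.map⟩
  · rw [Nat.card_congr e.toEquiv] at hcard
    have h1 : Nat.card (fixingGroup K L) = 2 := by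
      have : Nat.card (DihedralGroup 6) = 12 := by rw [DihedralGroup.nat_card]
      omega
    obtain ⟨r, hr⟩ := exists_rotationData_of_dihedral (c := e c)
      (H := (fixingGroup K L).map e.toMonoidHom)
      (by
        rw [← h1]
        exact Nat.card_congr
          ((fixingGroup K L).equivMapOfInjective _ e.injective).symm.toEquiv)
      (fun g => by
        obtain ⟨g, rfl⟩ := e.surjective g
        rw [← map_mul, ← map_mul, conj_central hc])
      (by rw [← map_mul, hcc, map_one]) (by simpa using hcH)
    exact ⟨_, hr.map⟩

end Conj

/-! ### Primitive types are arcs -/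

section Primitive

variable {K : Type*} [Field K] [NumberField K] [NumberField.IsCMField K]

/-- An imaginary quadratic subfield of a CM field is a CM field. -/
theorem isCMField_of_finrank_eq_two (F : IntermediateField ℚ K)
    (hF : Module.finrank ℚ F = 2) {y : K} (hy : y ∈ F) (hne : conjHom K y ≠ y) :
    NumberField.IsCMField F := by
  have : NumberField.IsTotallyComplex F := by
    refine ⟨fun w => ?_⟩
    obtain ⟨φ, rfl⟩ : ∃ φ, NumberField.InfinitePlace.mk φ = w := ⟨_, w.mk_embedding⟩
    rw [NumberField.InfinitePlace.isComplex_mk_iff, NumberField.ComplexEmbedding.isReal_iff]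
    intro h
    -- If `φ` were real, its lift to `K` would send `y` and its conjugate to the same number.
    refine hne ((NumberField.ComplexEmbedding.lift K φ).injective ?_)
    have h1 : NumberField.ComplexEmbedding.lift K φ y = φ ⟨y, hy⟩ :=
      NumberField.ComplexEmbedding.lift_algebraMap_apply K φ ⟨y, hy⟩
    refine (NumberField.IsCMField.complexEmbedding_complexConj K _ y).trans ?_
    rw [h1]
    exact RingHom.congr_fun h ⟨y, hy⟩
  have : Algebra.IsQuadraticExtension ℚ F := ⟨hF⟩
  exact NumberField.IsCMField.ofCMExtension ℚ F

/-- Any embedding into `ℂ` turns both sides into complex conjugation. -/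
theorem coe_conjHom (F : IntermediateField ℚ K) [NumberField.IsCMField F] (x : F) :
    (conjHom F x : K) = conjHom K (x : K) := by
  let e : K →+* ℂ := Classical.choice inferInstance
  apply e.injective
  exact (NumberField.IsCMField.complexEmbedding_complexConj F (e.comp (algebraMap F K)) x).trans
    (NumberField.IsCMField.complexEmbedding_complexConj K e x).symm

variable {L : Type*} [Field L] [NumberField L]

/-- A CM type whose elements are determined by their restriction to a CM subfield `F` is induced
from `F`. -/
theorem exists_isInducedBy [Algebra K L] [Normal ℚ L] (Φ : CMType K L) (F : IntermediateField ℚ K)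
    [NumberField.IsCMField F]
    (h : ∀ φ ψ : K →ₐ[ℚ] L, φ.comp F.val = ψ.comp F.val → φ ∈ Φ.embeddings → ψ ∈ Φ.embeddings) :
    ∃ Φ₀ : CMType F L, Φ.IsInducedBy F Φ₀ := by
  have hcomp (φ : K →ₐ[ℚ] L) : (φ.comp F.val).comp (conjHom F) =
      (φ.comp (conjHom K)).comp F.val := by
    ext x
    exact congrArg φ (coe_conjHom F x)
  have hmem (ψ : K →ₐ[ℚ] L) : ψ.comp F.val ∈ (fun φ => φ.comp F.val) '' Φ.embeddings ↔
      ψ ∈ Φ.embeddings :=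
    ⟨fun ⟨φ, hφ, e⟩ => h φ ψ e hφ, fun hψ => ⟨ψ, hψ, rfl⟩⟩
  refine ⟨⟨(fun φ => φ.comp F.val) '' Φ.embeddings, ?_, ?_⟩, ?_⟩
  · rw [Set.disjoint_left]
    rintro _ ⟨φ, hφ, rfl⟩ ⟨_, ⟨ψ, hψ, rfl⟩, e⟩
    exact Set.disjoint_left.1 Φ.disjoint_conj (h _ _ (((hcomp ψ).symm.trans e).symm) hφ)
      ⟨ψ, hψ, rfl⟩
  · rw [Set.eq_univ_iff_forall]
    intro χ
    obtain ⟨φ, rfl⟩ : ∃ φ : K →ₐ[ℚ] L, φ.comp F.val = χ := by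
      obtain ⟨σ, rfl⟩ := exists_comp_toAlgHom χ
      exact ⟨(σ : L →ₐ[ℚ] L).comp (IsScalarTower.toAlgHom ℚ K L), rfl⟩
    have : φ ∈ Φ.embeddings ∪ (fun φ => φ.comp (conjHom K)) '' Φ.embeddings :=
      Φ.union_conj ▸ Set.mem_univ φ
    obtain h1 | ⟨ψ, hψ, rfl⟩ := this
    · exact .inl ⟨φ, h1, rfl⟩
    · exact .inr ⟨_, ⟨ψ, hψ, rfl⟩, hcomp ψ⟩
  · ext ψ
    exact (hmem ψ).symm

variable [Algebra K L] [IsNormalClosure ℚ K L]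

/-- For a parity class the reflex field is quadratic, lies in `K` and is moved by `c`, so it is a CM
field that induces `Φ`. -/
theorem CMType.exists_zpow_mem_lift (hdeg : Module.finrank ℚ K = 6) {Φ : CMType K L}
    (hΦ : Φ.IsPrimitive) {c r : Gal(L/ℚ)}
    (hc : ∀ (φ : K →ₐ[ℚ] L) (x : K), c (φ x) = φ (conjHom K x))
    (hr : RotationData c (fixingGroup K L) r) :
    ∃ k : ℤ, r ^ (k - 1) ∈ Φ.lift ∧ r ^ k ∈ Φ.lift ∧ r ^ (k + 1) ∈ Φ.lift := by
  have : Normal ℚ L := IsNormalClosure.normal (K := K)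
  have : IsGalois ℚ L := ⟨⟩
  have hT := isTypeSet_lift hc Φ
  refine (hT.exists_or_forall hr).resolve_right fun h2 => ?_
  obtain ⟨hidx, hH, hr2, hcR⟩ := hT.index_stabilizer_eq_two hr h2
  have hfix : Φ.reflexField.fixingSubgroup = MulAction.stabilizer _ Φ.lift :=
    IntermediateField.fixingSubgroup_fixedField _
  have hle : Φ.reflexField ≤ (IsScalarTower.toAlgHom ℚ K L).fieldRange := by
    rw [← IsGalois.fixedField_fixingSubgroup (IsScalarTower.toAlgHom ℚ K L).fieldRange]
    exact IntermediateField.fixedField_antitone hH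
  let F : IntermediateField ℚ K := Φ.reflexField.comap (IsScalarTower.toAlgHom ℚ K L)
  have hmap : F.map (IsScalarTower.toAlgHom ℚ K L) = Φ.reflexField := by
    ext z
    constructor
    · rintro ⟨x, hx, rfl⟩
      exact hx
    · intro hz
      obtain ⟨x, rfl⟩ := hle hz
      exact ⟨x, hz, rfl⟩
  have hF2 : Module.finrank ℚ F = 2 := by
    rw [← hidx, ← hfix, ← IntermediateField.finrank_eq_fixingSubgroup_index, ← hmap]
    exact (F.equivMap (IsScalarTower.toAlgHom ℚ K L)).toLinearEquiv.finrank_eq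
  obtain ⟨y, hyF, hcy⟩ : ∃ y ∈ F, c (algebraMap K L y) ≠ algebraMap K L y := by
    by_contra! hcon
    refine hcR ?_
    rw [← hfix, ← hmap, IntermediateField.mem_fixingSubgroup_iff]
    rintro _ ⟨x, hx, rfl⟩
    exact hcon x hx
  have hpar (i : ℤ) (hi : 2 ∣ i) : r ^ i ∈ MulAction.stabilizer Gal(L/ℚ) Φ.lift := by
    obtain ⟨m, rfl⟩ := hi
    rw [zpow_mul]
    exact Subgroup.zpow_mem _ hr2 m
  have hfixF (i : ℤ) (hi : 2 ∣ i) {x : K} (hx : x ∈ F) :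
      (r ^ i) (algebraMap K L x) = algebraMap K L x := by
    have : r ^ i ∈ Φ.reflexField.fixingSubgroup := hfix ▸ hpar i hi
    exact (IntermediateField.mem_fixingSubgroup_iff _ _).1 this _ hx
  have : NumberField.IsCMField F := isCMField_of_finrank_eq_two F hF2 hyF fun e => hcy (by
    refine (hc (IsScalarTower.toAlgHom ℚ K L) y).trans ?_
    rw [e]; rfl)
  obtain ⟨Φ₀, hΦ₀⟩ := exists_isInducedBy Φ F (by
    intro φ ψ hφψ hφ
    obtain ⟨σ, rfl⟩ := exists_comp_toAlgHom φ
    obtain ⟨τ, rfl⟩ := exists_comp_toAlgHom ψ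
    obtain ⟨i, hi⟩ := hr.exists_zpow σ
    obtain ⟨j, hj⟩ := hr.exists_zpow τ
    have hval {ρ : Gal(L/ℚ)} {m : ℤ} (hm : r ^ (-m) * ρ ∈ fixingGroup K L) (x : K) :
        ρ (algebraMap K L x) = (r ^ m) (algebraMap K L x) := by
      have h := congrArg (r ^ m) (mem_fixingGroup_iff.1 hm x)
      rwa [← AlgEquiv.mul_apply, ← mul_assoc, ← zpow_add, add_neg_cancel, zpow_zero,
        one_mul] at h
    change τ ∈ Φ.lift
    have hσ : σ ∈ Φ.lift := hφ
    rw [hT.mem_iff_zpow hi] at hσ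
    rw [hT.mem_iff_zpow hj]
    by_cases hij : 2 ∣ j - i
    · have := (MulAction.mem_stabilizer_set.1 (hpar _ hij) (r ^ i)).2 hσ
      rwa [smul_eq_mul, ← zpow_add, sub_add_cancel] at this
    -- For `j - i` odd, agreement on `F` makes `r ^ (j - i)` fix `y`. So does the even power `r ^ (j
    -- - i + 3)`, hence `c` would fix `y`.
    · exfalso
      have h1 : (r ^ i) (algebraMap K L y) = (r ^ j) (algebraMap K L y) := by
        rw [← hval hi, ← hval hj]
        exact DFunLike.congr_fun hφψ ⟨y, hyF⟩
      have h3 : (r ^ (j - i)) (algebraMap K L y) = algebraMap K L y := by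
        rw [sub_eq_neg_add, zpow_add, AlgEquiv.mul_apply, ← h1, ← AlgEquiv.mul_apply, ← zpow_add,
          neg_add_cancel, zpow_zero, AlgEquiv.one_apply]
      have h4 := hfixF (j - i + 3) (by omega) hyF
      rw [hr.zpow_add_three, AlgEquiv.mul_apply, h3] at h4
      exact hcy h4)
  refine hΦ F Φ₀ ?_ hΦ₀
  intro htop
  rw [htop, IntermediateField.finrank_top', hdeg] at hF2
  norm_num at hF2

end Primitive

/-! ### Reduction to integral ideals -/

section Fractional

open FractionalIdeal

variable {K : Type*} [Field K] [NumberField K]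

theorem mk_toPrincipalIdeal (x : Kˣ) : ClassGroup.mk K (toPrincipalIdeal (𝓞 K) K x) = 1 := by
  rw [ClassGroup.mk_eq_one_iff, coe_toPrincipalIdeal]
  exact ⟨(x : K), by rw [coe_spanSingleton]⟩

variable [NumberField.IsCMField K]

theorem conjIdeal_mul (𝔞 𝔟 : FractionalIdeal (𝓞 K)⁰ K) :
    conjIdeal (𝔞 * 𝔟) = conjIdeal 𝔞 * conjIdeal 𝔟 :=
  extended_mul _ _ _ _

theorem conjIdeal_coeIdeal (I : Ideal (𝓞 K)) : conjIdeal (I : FractionalIdeal (𝓞 K)⁰ K) =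
    (I.map (NumberField.RingOfIntegers.mapRingHom (conjHom K : K →+* K)) :
      FractionalIdeal (𝓞 K)⁰ K) :=
  extended_coeIdeal_eq_map _ _ _

theorem conjIdeal_spanSingleton (x : K) : conjIdeal (spanSingleton (𝓞 K)⁰ x) =
    spanSingleton (𝓞 K)⁰ (conjHom K x) := by
  have hsmul (a : 𝓞 K) (u : K) : conjHom K (a • u) =
      (NumberField.RingOfIntegers.mapRingHom (conjHom K : K →+* K) a) • conjHom K u := by
    rw [Algebra.smul_def, Algebra.smul_def, map_mul]
    rfl
  ext z
  rw [mem_conjIdeal_iff, mem_spanSingleton, mem_spanSingleton]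
  constructor
  · rintro ⟨a, ha⟩
    refine ⟨NumberField.RingOfIntegers.mapRingHom (conjHom K : K →+* K) a, ?_⟩
    rw [← hsmul, ha]
    exact conjHom_conjHom z
  · rintro ⟨a, rfl⟩
    refine ⟨NumberField.RingOfIntegers.mapRingHom (conjHom K : K →+* K) a, ?_⟩
    change _ = conjHom K _
    rw [hsmul, conjHom_conjHom]

/-- An ideal class that contains a fractional ideal `𝔟` with `𝔟 * conjIdeal 𝔟` principal contains
such an integral ideal. -/
theorem exists_integral_of_mul_conjIdeal (𝔟 : (FractionalIdeal (𝓞 K)⁰ K)ˣ) {β : K} (hβ : β ≠ 0)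
    (h : (𝔟 : FractionalIdeal (𝓞 K)⁰ K) * conjIdeal (𝔟 : FractionalIdeal (𝓞 K)⁰ K) =
      spanSingleton (𝓞 K)⁰ β) :
    ∃ (I : (Ideal (𝓞 K))⁰) (b : 𝓞 K), b ≠ 0 ∧ ClassGroup.mk K 𝔟 = ClassGroup.mk0 I ∧
      (I : Ideal (𝓞 K)) *
        (I : Ideal (𝓞 K)).map (NumberField.RingOfIntegers.mapRingHom (conjHom K : K →+* K)) =
        Ideal.span {b} := by
  obtain ⟨a, I, ha, hI⟩ := exists_eq_spanSingleton_mul (𝔟 : FractionalIdeal (𝓞 K)⁰ K)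
  have haK : (a : K) ≠ 0 := NumberField.RingOfIntegers.coe_ne_zero_iff.mpr ha
  have hcK : conjHom K (a : K) ≠ 0 := by rwa [Ne, map_eq_zero]
  have hI0 : I ≠ ⊥ := by
    rintro rfl
    exact 𝔟.ne_zero (by rw [hI]; simp)
  -- Clearing the denominator `a` multiplies `β` by `a` and its conjugate; the new generator lies in
  -- an integral ideal, hence is an integer.
  have hprod : ((I * I.map (NumberField.RingOfIntegers.mapRingHom (conjHom K : K →+* K)) :
      Ideal (𝓞 K)) : FractionalIdeal (𝓞 K)⁰ K) =
      spanSingleton (𝓞 K)⁰ ((a : K) * conjHom K (a : K) * β) := by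
    rw [← spanSingleton_mul_spanSingleton, ← h, hI, conjIdeal_mul, conjIdeal_spanSingleton,
      conjIdeal_coeIdeal, coeIdeal_mul, map_inv₀]
    have h1 := spanSingleton_mul_spanSingleton (R := 𝓞 K) (S := (𝓞 K)⁰) ((a : K) * conjHom K (a : K))
      ((a : K)⁻¹ * (conjHom K (a : K))⁻¹)
    rw [show (a : K) * conjHom K (a : K) * ((a : K)⁻¹ * (conjHom K (a : K))⁻¹) = 1 by
      field_simp, spanSingleton_one, ← spanSingleton_mul_spanSingleton (a : K)⁻¹] at h1
    rw [mul_mul_mul_comm, ← mul_assoc, h1, one_mul]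
  have hmem := mem_spanSingleton_self (𝓞 K)⁰ ((a : K) * conjHom K (a : K) * β)
  rw [← hprod, mem_coeIdeal] at hmem
  obtain ⟨b, -, hb⟩ := hmem
  refine ⟨⟨I, mem_nonZeroDivisors_of_ne_zero hI0⟩, b, ?_, ?_, ?_⟩
  · rintro rfl
    rw [map_zero] at hb
    exact mul_ne_zero (mul_ne_zero haK hcK) hβ hb.symm
  · have : 𝔟 = toPrincipalIdeal (𝓞 K) K (Units.mk0 (a : K)⁻¹ (inv_ne_zero haK)) *
        FractionalIdeal.mk0 K ⟨I, mem_nonZeroDivisors_of_ne_zero hI0⟩ := by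
      ext1
      rw [hI, Units.val_mul, coe_toPrincipalIdeal]
      rfl
    rw [this, map_mul, mk_toPrincipalIdeal, one_mul, ClassGroup.mk_mk0]
  · rw [← coeIdeal_inj (K := K), hprod, coeIdeal_span_singleton, hb]

end Fractional

/-! ### Descent from `L` to `K` -/

section Descent

variable {K L : Type*} [Field K] [NumberField K] [Field L] [NumberField L] [Algebra K L]

theorem exists_algebraMap_eq_of_fixed [IsGalois ℚ L] (z : 𝓞 L)
    (h : ∀ σ ∈ fixingGroup K L, σ • z = z) : ∃ y : 𝓞 K, algebraMap (𝓞 K) (𝓞 L) y = z := by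
  have : IsGalois K L := IsGalois.tower_top_of_isGalois ℚ K L
  obtain ⟨y, hy⟩ := (IsGalois.mem_range_algebraMap_iff_fixed (F := K) (z : L)).mpr fun τ =>
    congrArg (fun w : 𝓞 L => (w : L)) (h (τ.restrictScalars ℚ)
      (mem_fixingGroup_iff.2 fun x => τ.commutes x))
  have hyint : IsIntegral ℤ y :=
    (isIntegral_algebraMap_iff (algebraMap K L).injective).mp (hy ▸ z.isIntegral_coe)
  exact ⟨⟨y, hyint⟩, NumberField.RingOfIntegers.ext hy⟩

theorem smul_map_algebraMap_of_mem {σ : Gal(L/ℚ)} (hσ : σ ∈ fixingGroup K L) (I : Ideal (𝓞 K)) :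
    σ • I.map (algebraMap (𝓞 K) (𝓞 L)) = I.map (algebraMap (𝓞 K) (𝓞 L)) := by
  rw [Ideal.pointwise_smul_def, Ideal.map_map]
  congr 1
  ext x
  exact mem_fixingGroup_iff.1 hσ x

theorem smul_algebraMap_of_mem {σ : Gal(L/ℚ)} (hσ : σ ∈ fixingGroup K L) (x : 𝓞 K) :
    σ • algebraMap (𝓞 K) (𝓞 L) x = algebraMap (𝓞 K) (𝓞 L) x :=
  NumberField.RingOfIntegers.ext (mem_fixingGroup_iff.1 hσ x)

theorem smul_span_singleton (σ : Gal(L/ℚ)) (x : 𝓞 L) :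
    σ • Ideal.span {x} = Ideal.span {σ • x} := by
  rw [Ideal.pointwise_smul_def, Ideal.map_span, Set.image_singleton]
  rfl

theorem smul_conj_map_algebraMap [NumberField.IsCMField K] {c : Gal(L/ℚ)}
    (hc : ∀ (φ : K →ₐ[ℚ] L) (x : K), c (φ x) = φ (conjHom K x)) (I : Ideal (𝓞 K)) :
    c • I.map (algebraMap (𝓞 K) (𝓞 L)) =
      (I.map (NumberField.RingOfIntegers.mapRingHom (conjHom K : K →+* K))).map
        (algebraMap (𝓞 K) (𝓞 L)) := by
  rw [Ideal.pointwise_smul_def, Ideal.map_map, Ideal.map_map]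
  congr 1
  ext x
  exact hc (IsScalarTower.toAlgHom ℚ K L) x

end Descent

/-! ### The reflex type of an arc -/

section Reflex

variable {K L : Type*} [Field K] [NumberField K] [NumberField.IsCMField K]
  [Field L] [NumberField L] [Algebra K L]

/-- The restriction of an automorphism of `L` to the reflex field. -/
def CMType.restrictReflex (Φ : CMType K L) (σ : Gal(L/ℚ)) : Φ.reflexField →ₐ[ℚ] L :=
  (σ : L →ₐ[ℚ] L).comp Φ.reflexField.val

theorem CMType.restrictReflex_eq_iff (Φ : CMType K L) (σ τ : Gal(L/ℚ)) :
    Φ.restrictReflex σ = Φ.restrictReflex τ ↔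
      σ⁻¹ * τ ∈ MulAction.stabilizer Gal(L/ℚ) Φ.lift := by
  have hfix : Φ.reflexField.fixingSubgroup = MulAction.stabilizer _ Φ.lift :=
    IntermediateField.fixingSubgroup_fixedField _
  rw [← hfix, IntermediateField.mem_fixingSubgroup_iff]
  constructor
  · intro h x hx
    change σ.symm (τ x) = x
    rw [AlgEquiv.symm_apply_eq]
    exact (DFunLike.congr_fun h ⟨x, hx⟩).symm
  · intro h
    ext x
    have h1 : σ.symm (τ (x : L)) = x := h x x.2
    exact ((AlgEquiv.symm_apply_eq σ).1 h1).symm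

variable {Φ : CMType K L} {c r : Gal(L/ℚ)} {k : ℤ}

/-- Write `σ⁻¹ = r ^ i * y` with `y ∈ H`. Then `σ` and `r ^ (e - k)` agree on the reflex field when
`r ^ (i - k) * y * r ^ e ∈ H`. So `e` is `k - i` if `y` commutes with `r` and `i - k` if `y` inverts
it, modulo 6. -/
theorem CMType.reflexType_eq (hT : IsTypeSet c (fixingGroup K L) Φ.lift)
    (hr : RotationData c (fixingGroup K L) r)
    (hk : ∀ i : ℤ, r ^ i ∈ Φ.lift ↔ 6 ∣ i - k ∨ 6 ∣ i - k - 1 ∨ 6 ∣ i - k + 1) :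
    Φ.reflexType = (fun e : ℤ => Φ.restrictReflex (r ^ (e - k))) ''
      ({-1, 0, 1} : Set ℤ) := by
  ext φ
  constructor
  · rintro ⟨σ, hσ, rfl⟩
    rw [Set.mem_inv] at hσ
    obtain ⟨i, hi⟩ := hr.exists_zpow σ⁻¹
    rw [hT.mem_iff_zpow hi, hk] at hσ
    have key (e : ℤ) : r ^ (-k) * (σ⁻¹ * r ^ (e - k)) * r ^ k =
        r ^ (i - k) * ((r ^ (-i) * σ⁻¹) * r ^ e) := by
      simp only [zpow_sub, zpow_neg]; group
    have hex : ∃ e ∈ ({-1, 0, 1} : Set ℤ),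
        r ^ (i - k) * ((r ^ (-i) * σ⁻¹) * r ^ e) ∈ fixingGroup K L := by
      rcases hr.mul_zpow hi with h' | h'
      · have : ∃ e ∈ ({-1, 0, 1} : Set ℤ), 6 ∣ i - k + e := by
          rcases hσ with h | h | h
          · exact ⟨0, by simp, by omega⟩
          · exact ⟨-1, by simp, by omega⟩
          · exact ⟨1, by simp, by omega⟩
        obtain ⟨e, he, h6⟩ := this
        refine ⟨e, he, ?_⟩
        rwa [h', ← mul_assoc, ← zpow_add, hr.zpow_eq_one h6, one_mul]
      · have : ∃ e ∈ ({-1, 0, 1} : Set ℤ), 6 ∣ i - k + -e := by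
          rcases hσ with h | h | h
          · exact ⟨0, by simp, by omega⟩
          · exact ⟨1, by simp, by omega⟩
          · exact ⟨-1, by simp, by omega⟩
        obtain ⟨e, he, h6⟩ := this
        refine ⟨e, he, ?_⟩
        rwa [h', ← mul_assoc, ← zpow_add, hr.zpow_eq_one h6, one_mul]
    obtain ⟨e, he, hmem⟩ := hex
    refine ⟨e, he, Eq.symm ?_⟩
    change Φ.restrictReflex σ = Φ.restrictReflex _
    rw [Φ.restrictReflex_eq_iff, hT.mem_stabilizer_iff hr hk, key]
    exact hmem
  · rintro ⟨e, he, rfl⟩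
    refine ⟨_, ?_, rfl⟩
    rw [Set.mem_inv, ← zpow_neg, hk]
    rcases he with rfl | rfl | rfl <;> omega

theorem CMType.prodEmb_reflexType (hT : IsTypeSet c (fixingGroup K L) Φ.lift)
    (hr : RotationData c (fixingGroup K L) r)
    (hk : ∀ i : ℤ, r ^ i ∈ Φ.lift ↔ 6 ∣ i - k ∨ 6 ∣ i - k - 1 ∨ 6 ∣ i - k + 1)
    (J : Ideal (𝓞 Φ.reflexField)) :
    prodEmb Φ.reflexType J =
      r ^ (-1 - k) • J.map (algebraMap (𝓞 Φ.reflexField) (𝓞 L)) *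
      (r ^ (0 - k) • J.map (algebraMap (𝓞 Φ.reflexField) (𝓞 L)) *
        r ^ (1 - k) • J.map (algebraMap (𝓞 Φ.reflexField) (𝓞 L))) := by
  -- The product runs over a set of embeddings, so the three representatives must be distinct.
  have hinj : Set.InjOn (fun e : ℤ => Φ.restrictReflex (r ^ (e - k))) ({-1, 0, 1} : Set ℤ) := by
    intro e he e' he' h
    have h' := (Φ.restrictReflex_eq_iff _ _).1 h
    rw [hT.mem_stabilizer_iff hr hk] at h'
    have h6 := hr.dvd_of_mem (e' - e) (by
      convert h' using 1
      simp only [zpow_sub, zpow_neg]; group)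
    rcases he with rfl | rfl | rfl <;> rcases he' with rfl | rfl | rfl <;> omega
  unfold prodEmb
  rw [CMType.reflexType_eq hT hr hk, finprod_mem_image hinj, finprod_mem_insert _ (by simp)
    (Set.toFinite _), finprod_mem_pair (by norm_num)]
  have hmap (σ : Gal(L/ℚ)) : J.map (NumberField.RingOfIntegers.mapRingHom (Φ.restrictReflex σ)) =
      σ • J.map (algebraMap (𝓞 Φ.reflexField) (𝓞 L)) := map_mapRingHom_comp_val σ J
  rw [hmap, hmap, hmap]

/-- The product of two neighbouring conjugates of an ideal of `K` is extended from the reflex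
field. -/
theorem CMType.exists_map_eq_smul_mul_smul (hT : IsTypeSet c (fixingGroup K L) Φ.lift)
    (hr : RotationData c (fixingGroup K L) r)
    (hk : ∀ i : ℤ, r ^ i ∈ Φ.lift ↔ 6 ∣ i - k ∨ 6 ∣ i - k - 1 ∨ 6 ∣ i - k + 1) [IsGalois ℚ L]
    {B : Ideal (𝓞 L)} (hB : ∀ σ ∈ fixingGroup K L, σ • B = B) :
    ∃ J : Ideal (𝓞 Φ.reflexField), J.map (algebraMap (𝓞 Φ.reflexField) (𝓞 L)) =
      r ^ (k + 1) • B * r ^ (k - 1) • B := by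
  -- If `H` is trivial so is the reflex group, and the product itself descends. Otherwise the reflex
  -- group is generated by `r ^ k * t * r ^ (-k)`, which takes `r ^ (k + 1) • B` to `r ^ (k - 1) •
  -- B`, so the product is a relative norm.
  rcases hr.subgroup_eq with hH | ⟨t, ht, hH, htr⟩
  · have hR : (Φ.reflexGroup : Set Gal(L/ℚ)) = {1} := by
      ext x
      refine (hT.mem_stabilizer_iff hr hk x).trans ?_
      rw [hH, Subgroup.mem_bot, Set.mem_singleton_iff]
      constructor
      · intro h
        rw [zpow_neg, mul_assoc, inv_mul_eq_one] at h
        exact mul_eq_right.mp h.symm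
      · rintro rfl
        simp
    obtain ⟨J, hJ⟩ := exists_map_eq_finprod_smul Φ.reflexGroup (r ^ (k + 1) • B * r ^ (k - 1) • B)
    refine ⟨J, hJ.trans ?_⟩
    change ∏ᶠ τ ∈ (Φ.reflexGroup : Set Gal(L/ℚ)), τ • _ = _
    rw [hR, finprod_mem_singleton, one_smul]
  · have hR : (Φ.reflexGroup : Set Gal(L/ℚ)) = {1, r ^ k * t * r ^ (-k)} := by
      ext x
      refine (hT.mem_stabilizer_iff hr hk x).trans ?_
      rw [← SetLike.mem_coe, hH]
      simp only [Set.mem_insert_iff, Set.mem_singleton_iff]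
      refine or_congr ?_ ?_
      · constructor
        · intro h
          rw [zpow_neg, mul_assoc, inv_mul_eq_one] at h
          exact mul_eq_right.mp h.symm
        · rintro rfl
          simp
      · constructor
        · rintro rfl
          simp only [zpow_neg]; group
        · rintro rfl
          simp only [zpow_neg]; group
    have htH : t ∈ fixingGroup K L := by
      rw [← SetLike.mem_coe, hH]
      simp
    obtain ⟨J, hJ⟩ := exists_map_eq_finprod_smul Φ.reflexGroup (r ^ (k + 1) • B)
    refine ⟨J, hJ.trans ?_⟩
    change ∏ᶠ τ ∈ (Φ.reflexGroup : Set Gal(L/ℚ)), τ • _ = _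
    have hne : 1 ≠ r ^ k * t * r ^ (-k) := by
      intro h
      apply ht
      rw [eq_comm, zpow_neg, mul_inv_eq_one] at h
      exact mul_eq_left.mp h
    rw [hR, finprod_mem_pair hne, one_smul, smul_smul]
    congr 1
    have : r ^ k * t * r ^ (-k) * r ^ (k + 1) = r ^ (k - 1) * t := by
      rw [zpow_sub_one, mul_assoc (r ^ k) r⁻¹, ← htr]
      simp only [zpow_neg]; group
    rw [this, mul_smul, hB t htH]

end Reflex

/-! ### The type norm of `J` and the conclusion -/

section Main

variable {K L : Type*} [Field K] [NumberField K] [NumberField.IsCMField K]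
  [Field L] [NumberField L] [Algebra K L] {Φ : CMType K L} {c r : Gal(L/ℚ)} {k : ℤ}

/-- An identity in the group ring acting on ideals: with `T = r + r⁻¹` and `c = r ^ 3`,
`(1 + T) * T = 2 + (r + r⁻¹) * (1 + c)`. -/
theorem RotationData.smul_prod_eq {H : Subgroup Gal(L/ℚ)} (hr : RotationData c H r)
    (B : Ideal (𝓞 L)) :
    r ^ (-1 - k) • (r ^ (k + 1) • B * r ^ (k - 1) • B) *
      (r ^ (0 - k) • (r ^ (k + 1) • B * r ^ (k - 1) • B) *
        r ^ (1 - k) • (r ^ (k + 1) • B * r ^ (k - 1) • B)) =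
    B ^ 2 * (r ^ (1 : ℤ) • (B * c • B) * r ^ (-1 : ℤ) • (B * c • B)) := by
  have hc : c = r ^ (3 : ℤ) := by rw [← hr.cube]; norm_cast
  -- The left side produces the exponent `-2`, while `r * c` on the right gives `4`.
  have h2 : r ^ (-2 : ℤ) = r ^ (4 : ℤ) := by
    rw [show (4 : ℤ) = -2 + 6 by norm_num, zpow_add, hr.zpow_eq_one (dvd_refl 6), mul_one]
  simp only [smul_mul', smul_smul, ← zpow_add, hc]
  ring_nf
  rw [h2, zpow_zero, one_smul]
  ring

theorem CMType.mk0_sq_mem_range_reflexTypeNorm [IsGalois ℚ L]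
    (hT : IsTypeSet c (fixingGroup K L) Φ.lift)
    (hr : RotationData c (fixingGroup K L) r)
    (hk : ∀ i : ℤ, r ^ i ∈ Φ.lift ↔ 6 ∣ i - k ∨ 6 ∣ i - k - 1 ∨ 6 ∣ i - k + 1)
    (hc : ∀ (φ : K →ₐ[ℚ] L) (x : K), c (φ x) = φ (conjHom K x))
    (I : (Ideal (𝓞 K))⁰) {b : 𝓞 K} (hb : b ≠ 0) (hI : (I : Ideal (𝓞 K)) *
      (I : Ideal (𝓞 K)).map (NumberField.RingOfIntegers.mapRingHom (conjHom K : K →+* K)) =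
        Ideal.span {b}) :
    ClassGroup.mk0 (I ^ 2) ∈ Set.range Φ.reflexTypeNorm := by
  set B := (I : Ideal (𝓞 K)).map (algebraMap (𝓞 K) (𝓞 L)) with hBdef
  have hBH : ∀ σ ∈ fixingGroup K L, σ • B = B := fun σ hσ => smul_map_algebraMap_of_mem hσ _
  have hBc : B * c • B = Ideal.span {algebraMap (𝓞 K) (𝓞 L) b} := by
    rw [hBdef, smul_conj_map_algebraMap hc, ← Ideal.map_mul, hI, Ideal.map_span,
      Set.image_singleton]
  obtain ⟨J, hJ⟩ := CMType.exists_map_eq_smul_mul_smul hT hr hk hBH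
  -- An element of `H` fixes or swaps the two factors `r • b` and `r⁻¹ • b`, so their product lies
  -- in `K`.
  obtain ⟨d, hd⟩ := exists_algebraMap_eq_of_fixed (K := K)
    (r ^ (1 : ℤ) • algebraMap (𝓞 K) (𝓞 L) b * r ^ (-1 : ℤ) • algebraMap (𝓞 K) (𝓞 L) b) (by
      intro σ hσ
      rcases hr.mul_zpow hσ with h | h
      · rw [smul_mul', smul_smul, smul_smul, h, h, mul_smul, mul_smul,
          smul_algebraMap_of_mem hσ]
      · rw [smul_mul', smul_smul, smul_smul, h, h, mul_smul, mul_smul,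
          smul_algebraMap_of_mem hσ, neg_neg, mul_comm])
  have hprod : prodEmb Φ.reflexType J =
      ((I : Ideal (𝓞 K)) ^ 2 * Ideal.span {d}).map (algebraMap (𝓞 K) (𝓞 L)) := by
    rw [CMType.prodEmb_reflexType hT hr hk, hJ, hr.smul_prod_eq, hBc, smul_span_singleton,
      smul_span_singleton, Ideal.span_singleton_mul_span_singleton, ← hd, Ideal.map_mul,
      Ideal.map_pow, Ideal.map_span, Set.image_singleton]
  have hd0 : d ≠ 0 := by
    rintro rfl
    rw [map_zero, eq_comm, mul_eq_zero, smul_eq_zero_iff_eq, smul_eq_zero_iff_eq, or_self,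
      FaithfulSMul.algebraMap_eq_zero_iff] at hd
    exact hb hd
  have hB0 : B ≠ ⊥ := fun h => nonZeroDivisors.coe_ne_zero I
    ((Ideal.map_eq_bot_iff_of_injective (FaithfulSMul.algebraMap_injective _ _)).1 h)
  have hJ0 : J ≠ ⊥ := by
    rintro rfl
    rw [Ideal.map_bot, eq_comm, ← Ideal.zero_eq_bot, mul_eq_zero, smul_eq_zero_iff_eq,
      smul_eq_zero_iff_eq, or_self] at hJ
    exact hB0 hJ
  refine ⟨ClassGroup.mk0 ⟨J, mem_nonZeroDivisors_of_ne_zero hJ0⟩, ?_⟩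
  rw [CMType.reflexTypeNorm_mk0, ClassGroup.mk0_eq_mk0_iff]
  refine ⟨1, d, one_ne_zero, hd0, ?_⟩
  change Ideal.span {1} * (prodEmb Φ.reflexType J).comap (algebraMap (𝓞 K) (𝓞 L)) = _
  rw [hprod, comap_map_algebraMap, Ideal.span_singleton_one, Ideal.top_mul, mul_comm]
  rfl

end Main

end CMReflex

theorem mainTheorem3 {K L : Type*} [Field K] [NumberField K] [NumberField.IsCMField K]
    [Field L] [NumberField L] [Algebra K L] [IsNormalClosure ℚ K L]
    (hdeg : Module.finrank ℚ K = 6)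
    (hgal : Nonempty (Gal(L/ℚ) ≃* Multiplicative (ZMod 6)) ∨
      Nonempty (Gal(L/ℚ) ≃* DihedralGroup 6))
    (Φ : CMReflex.CMType K L) (hΦ : Φ.IsPrimitive)
    (𝔟 : (FractionalIdeal (𝓞 K)⁰ K)ˣ)
    (β : NumberField.maximalRealSubfield K) (hβ : β ≠ 0)
    (h𝔟 : (𝔟 : FractionalIdeal (𝓞 K)⁰ K) * CMReflex.conjIdeal (𝔟 : FractionalIdeal (𝓞 K)⁰ K) =
      FractionalIdeal.spanSingleton (𝓞 K)⁰ (β : K)) :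
    ClassGroup.mk K (𝔟 ^ 2) ∈ Set.range Φ.reflexTypeNorm := by
  have : Normal ℚ L := IsNormalClosure.normal (K := K)
  have : IsGalois ℚ L := ⟨⟩
  obtain ⟨c, hc⟩ := CMReflex.exists_conj K L
  obtain ⟨r, hr⟩ := CMReflex.exists_rotationData hdeg hgal hc
  obtain ⟨k, h1, h2, h3⟩ := CMReflex.CMType.exists_zpow_mem_lift hdeg hΦ hc hr
  have hT := CMReflex.isTypeSet_lift hc Φ
  obtain ⟨I, b, hb, hmk, hI⟩ := CMReflex.exists_integral_of_mul_conjIdeal 𝔟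
    (fun h => hβ (Subtype.ext h)) h𝔟
  rw [map_pow, hmk, ← map_pow]
  exact CMReflex.CMType.mk0_sq_mem_range_reflexTypeNorm hT hr (hT.zpow_mem_iff hr h1 h2 h3) hc I
    hb hI
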